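/- Let $N\ge 0$, $a=(a_1,\dots,a_{N-1})\in\mathbb C^{N-1}$ and $t\in\mathbb R$. Let $A=A^{(a)}$ be the $N\times N$ matrix with $A_{j,j-1}=a_{j-1}$ ($2\le j\le N$) and all other entries $0$, let $J=\mathrm{diag}(1,2,\dots,N)$, and put $$W^{(a)}(x)=e^{-x^2}e^{xA}e^{xA^*},\qquad \mathcal C^{(a)}(x)=J-xA,\qquad W(x;t)=e^{-t\,\mathcal C^{(a)}(x)}W^{(a)}(x),\qquad x\in\mathbb R .$$ For a matrix weight $W$ on $\mathbb R$ and $P,Q\in M_N(\mathbb C)[x]$ write $\langle P,Q\rangle_W=\int_{\mathbb R}P(x)W(x)Q(x)^*\,dx$. Monic orthogonal polynomials for $W$ are polynomials $P_n(x)=x^nI+(\text{lower degree})$, $n\ge 0$, with $\langle P_n,P_m\rangle_W=\delta_{n,m}\mathcal H_n$ and $\mathcal H_n$ positive definite; $P_n(x;t)$ denotes those for $W(x;t)$. Differential operators $E=\sum_j\partial_x^jF_j(x)$, with finitely many rational coefficients $F_j$ in $M_N(\mathbb C(x))$, act from the right by $P\cdot E=\sum_j(\partial_x^jP)F_j$.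 Difference operators $M=\sum_jG_j(n)\delta^j$ (a finite sum over $j\in\mathbb Z$, with $G_j:\mathbb N_0\to M_N(\mathbb C)$) act from the left by $(M\cdot P)_n=\sum_jG_j(n)P_{n+j}$, where $P_m=0$ for $m<0$. Let $\mathcal F_R(P;t)$ be the set of differential operators $E$ for which there is a difference operator $M$ with $P_n(x;t)\cdot E=(M\cdot P)_n(x;t)$ for all $n\ge0$. Put $\sigma(E)=e^{-\frac t2J}Ee^{\frac t2J}=\sum_j\partial_x^j\,e^{-\frac t2J}F_j(x)e^{\frac t2J}$ and $$D^{(a)}=\frac{d}{dx}+A,\qquad (D^{(a)})^\dagger=-D^{(a)}+2x,\qquad \mathcal D^{(a)}=\frac{d^2}{dx^2}+\frac{d}{dx}(2A-2x)+A^2-2J,$$ and regard $\mathcal C^{(a)}=J-xA$ as an operator of order zero. Then $(D^{(a)})^\dagger$ is the adjoint of $D^{(a)}$ for $W^{(a)}$, that is, $\langle P\cdot D^{(a)},Q\rangle_{W^{(a)}}=\langle P,Q\cdot (D^{(a)})^\dagger\rangle_{W^{(a)}}$ for all $P,Q\in M_N(\mathbb C)[x]$, monic orthogonal polynomials $P_n(x;t)$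 for $W(x;t)$ exist, and the following hold. 1. $\sigma(D^{(e^{t/2}a)})=D^{(a)}$, $\ \sigma((D^{(e^{t/2}a)})^\dagger)=(D^{(a)})^\dagger$, $\ \sigma(\mathcal D^{(e^{t/2}a)})=\mathcal D^{(a)}$, $\ \sigma(\mathcal C^{(e^{t/2}a)})=\mathcal C^{(a)}$. 2. The operators $D^{(a)}$, $(D^{(a)})^\dagger$, $\mathcal D^{(a)}$ and $\mathcal C^{(a)}$ belong to $\mathcal F_R(P;t)$. 3. The polynomials $P_n(x;t)$ are eigenfunctions of $\mathcal D^{(a)}$: for every $n\ge 0$ there is a constant matrix $\Gamma_n\in M_N(\mathbb C)$, which may depend on $t$, with $P_n(x;t)\cdot\mathcal D^{(a)}=\Gamma_nP_n(x;t)$. -/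

import Mathlib

open Polynomial Matrix MeasureTheory
open scoped ComplexOrder

noncomputable section

namespace MatrixHermite

/-! ### Matrix polynomials, weights and orthogonal polynomials -/

/-- Matrix polynomials `M_N(ℂ)[x]`, as matrices with polynomial entries. -/
abbrev MatPoly (N : ℕ) : Type := Matrix (Fin N) (Fin N) ℂ[X]

/-- The value `P(x)` of a matrix polynomial at a real point. -/
def evalAt {N : ℕ} (P : MatPoly N) (x : ℝ) : Matrix (Fin N) (Fin N) ℂ :=
  P.map (fun p => p.eval (x : ℂ))

/-- The matrix valued inner product `⟨P, Q⟩ = ∫ P(x) W(x) Q(x)^* dx` over the real line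
(integrated entry by entry). -/
def matInner {N : ℕ} (W : ℝ → Matrix (Fin N) (Fin N) ℂ) (P Q : MatPoly N) :
    Matrix (Fin N) (Fin N) ℂ :=
  Matrix.of fun i j => ∫ x : ℝ, (evalAt P x * W x * (evalAt Q x)ᴴ) i j

/-- `P = x^n I + (terms of lower degree)`. -/
def IsMonicOfDegree {N : ℕ} (n : ℕ) (P : MatPoly N) : Prop :=
  ∀ i j, (P i j).coeff n = (1 : Matrix (Fin N) (Fin N) ℂ) i j ∧
    ∀ m, n < m → (P i j).coeff m = 0

/-- `(P_n)` is a sequence of monic matrix valued orthogonal polynomials for the weight `W`: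
`P_n` is monic of degree `n` and `⟨P_n, P_m⟩ = δ_{n,m} H_n` with `H_n` positive definite. -/
structure IsMonicMVOP {N : ℕ} (W : ℝ → Matrix (Fin N) (Fin N) ℂ) (P : ℕ → MatPoly N) :
    Prop where
  monic : ∀ n, IsMonicOfDegree n (P n)
  orthogonal : ∀ n m, n ≠ m → matInner W (P n) (P m) = 0
  posDef : ∀ n, (matInner W (P n) (P n)).PosDef

/-! ### Differential and difference operators -/

/-- Differential operators `∑_j ∂_x^j F_j(x)` with rational matrix coefficients; such an operator
is given by its finitely many nonzero coefficients `F_j`. -/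
abbrev DiffOp (N : ℕ) : Type := ℕ →₀ Matrix (Fin N) (Fin N) (RatFunc ℂ)

/-- A matrix polynomial, seen as a matrix of rational functions. -/
def toRat {N : ℕ} (P : MatPoly N) : Matrix (Fin N) (Fin N) (RatFunc ℂ) :=
  P.map (algebraMap ℂ[X] (RatFunc ℂ))

/-- A constant matrix, seen as a matrix polynomial. -/
def constPoly {N : ℕ} (A : Matrix (Fin N) (Fin N) ℂ) : MatPoly N := A.map Polynomial.C

/-- A constant matrix, seen as a matrix of rational functions. -/
def constRat {N : ℕ} (A : Matrix (Fin N) (Fin N) ℂ) : Matrix (Fin N) (Fin N) (RatFunc ℂ) :=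
  toRat (constPoly A)

/-- The right action `P · E = ∑_j (∂_x^j P) F_j` of `E = ∑_j ∂_x^j F_j` on matrix polynomials. -/
def act {N : ℕ} (P : MatPoly N) (E : DiffOp N) : Matrix (Fin N) (Fin N) (RatFunc ℂ) :=
  E.sum fun j F => toRat (P.map (fun p => derivative^[j] p)) * F

/-- Difference operators `∑_j G_j(n) δ^j`, a finite sum over `j ∈ ℤ`, with coefficients
`G_j : ℕ → M_N(ℂ)`. -/
abbrev DiffceOp (N : ℕ) : Type := ℤ →₀ (ℕ → Matrix (Fin N) (Fin N) ℂ)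

/-- The sequence `(P_n)` extended by `P_n = 0` for `n < 0`. -/
def extZero {N : ℕ} (P : ℕ → MatPoly N) (m : ℤ) : MatPoly N :=
  if 0 ≤ m then P m.toNat else 0

/-- The left action `(M · P)_n = ∑_j G_j(n) P_{n+j}` of a difference operator. -/
def shiftAct {N : ℕ} (M : DiffceOp N) (P : ℕ → MatPoly N) (n : ℕ) : MatPoly N :=
  M.sum fun j G => constPoly (G n) * extZero P ((n : ℤ) + j)

/-- The right Fourier algebra `F_R(P)`: the differential operators `E` for which there is a
difference operator `M` with `M · P_n = P_n · E` for all `n`. -/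
def rightFourier {N : ℕ} (P : ℕ → MatPoly N) : Set (DiffOp N) :=
  {E | ∃ M : DiffceOp N, ∀ n, toRat (shiftAct M P n) = act (P n) E}

/-- `F` is an adjoint of `E` on matrix polynomials for the weight `W`: both map matrix polynomials
to matrix polynomials, and `⟨P · E, Q⟩ = ⟨P, Q · F⟩`. -/
def IsAdjoint {N : ℕ} (W : ℝ → Matrix (Fin N) (Fin N) ℂ) (E F : DiffOp N) : Prop :=
  ∀ P Q : MatPoly N, ∃ P' Q' : MatPoly N,
    toRat P' = act P E ∧ toRat Q' = act Q F ∧ matInner W P' Q = matInner W P Q'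

/-! ### The Hermite-type weight, its deformation and its operators -/

/-- The matrix `A` with `A_{j,j-1} = a_{j-1}` below the diagonal and zeros elsewhere. -/
def matA {N : ℕ} (a : Fin (N - 1) → ℂ) : Matrix (Fin N) (Fin N) ℂ :=
  Matrix.of fun j k => if h : (k : ℕ) + 1 = (j : ℕ) then a ⟨k, by omega⟩ else 0

/-- The matrix `J = diag(1, 2, …, N)`. -/
def matJ (N : ℕ) : Matrix (Fin N) (Fin N) ℂ :=
  Matrix.diagonal fun i => ((i : ℕ) : ℂ) + 1

/-- The weight `W^{(a)}(x) = e^{-x²} e^{xA} e^{xA^*}`. -/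
def weight {N : ℕ} (a : Fin (N - 1) → ℂ) (x : ℝ) : Matrix (Fin N) (Fin N) ℂ :=
  (Real.exp (-x ^ 2) : ℂ) •
    (NormedSpace.exp ((x : ℂ) • matA a) * NormedSpace.exp ((x : ℂ) • (matA a)ᴴ))

/-- The matrix polynomial `J - xA`. -/
def casimirPoly {N : ℕ} (a : Fin (N - 1) → ℂ) : MatPoly N :=
  constPoly (matJ N) - (X : ℂ[X]) • constPoly (matA a)

/-- The deformed weight `W(x;t) = e^{-t (J - xA)} W^{(a)}(x)`. -/
def deformedWeight {N : ℕ} (a : Fin (N - 1) → ℂ) (t : ℝ) (x : ℝ) : Matrix (Fin N) (Fin N) ℂ :=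
  NormedSpace.exp (-(t : ℂ) • evalAt (casimirPoly a) x) * weight a x

/-- `D^{(a)} = d/dx + A`. -/
def opD {N : ℕ} (a : Fin (N - 1) → ℂ) : DiffOp N :=
  Finsupp.single 1 1 + Finsupp.single 0 (constRat (matA a))

/-- `(D^{(a)})^† = -D^{(a)} + 2x`. -/
def opDdag {N : ℕ} (a : Fin (N - 1) → ℂ) : DiffOp N :=
  -opD a + Finsupp.single 0 ((2 * RatFunc.X : RatFunc ℂ) • 1)

/-- The second-order operator `d²/dx² + d/dx (2A - 2x) + A² - 2J`. -/
def opSecond {N : ℕ} (a : Fin (N - 1) → ℂ) : DiffOp N :=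
  Finsupp.single 2 1
    + Finsupp.single 1 ((2 : RatFunc ℂ) • constRat (matA a) - (2 * RatFunc.X : RatFunc ℂ) • 1)
    + Finsupp.single 0 (constRat (matA a ^ 2 - (2 : ℂ) • matJ N))

/-- The Casimir operator: the operator of order zero `J - xA`. -/
def opCasimir {N : ℕ} (a : Fin (N - 1) → ℂ) : DiffOp N :=
  Finsupp.single 0 (toRat (casimirPoly a))

/-- The parameters `e^{t/2} a`. -/
def scaled {N : ℕ} (t : ℝ) (a : Fin (N - 1) → ℂ) : Fin (N - 1) → ℂ :=
  fun k => (Real.exp (t / 2) : ℂ) * a k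

/-- The matrix `e^{sJ}`. -/
def expJ (N : ℕ) (s : ℝ) : Matrix (Fin N) (Fin N) ℂ := NormedSpace.exp ((s : ℂ) • matJ N)

/-- The map `σ(E) = e^{-tJ/2} E e^{tJ/2}`. The operators act from the right, so the product of
`E = ∑_j ∂_x^j F_j` with the constants is `∑_j ∂_x^j e^{-tJ/2} F_j e^{tJ/2}`; see `act_sigma`. -/
def sigma {N : ℕ} (t : ℝ) (E : DiffOp N) : DiffOp N :=
  Finsupp.mapRange (fun F => constRat (expJ N (-(t / 2))) * F * constRat (expJ N (t / 2)))
    (by simp) E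

theorem map_derivative_mul_constPoly {N : ℕ} (P : MatPoly N) (L : Matrix (Fin N) (Fin N) ℂ)
    (j : ℕ) : (P * constPoly L).map (fun p => derivative^[j] p)
      = P.map (fun p => derivative^[j] p) * constPoly L := by
  ext1 r s
  simp only [Matrix.map_apply, Matrix.mul_apply, constPoly, Polynomial.iterate_derivative_sum]
  refine Finset.sum_congr rfl fun k _ => ?_
  rw [mul_comm, Polynomial.iterate_derivative_C_mul, mul_comm]

/-- `σ(E)` acts as the composition of `e^{-tJ/2}`, `E` and `e^{tJ/2}`, in this order. -/
theorem act_sigma {N : ℕ} (t : ℝ) (P : MatPoly N) (E : DiffOp N) :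
    act P (sigma t E)
      = act (P * constPoly (expJ N (-(t / 2)))) E * constRat (expJ N (t / 2)) := by
  unfold act sigma
  rw [Finsupp.sum_mapRange_index (by simp), Finsupp.sum, Finsupp.sum, Finset.sum_mul]
  refine Finset.sum_congr rfl fun j _ => ?_
  rw [map_derivative_mul_constPoly]
  simp only [toRat, constRat, Matrix.map_mul, Matrix.mul_assoc]

end MatrixHermite

end

open MatrixHermite

noncomputable section

namespace MatrixHermite

variable {N : ℕ}

section

/-! ### Algebra of matrix polynomials -/

/-! Since `[J, A] = A`, the Casimir is a conjugate of `J`: `(J - xA) e^{xA} = e^{xA} J`.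
Exponentiating (`exp_casimir_mul`) turns the deformed weight into `e^{-x²} w` with `w = e^{xA}
e^{-tJ} e^{xA^*}`, a polynomial because `A` is nilpotent. Every pairing thus reduces to the scalar
Gaussian functional, and positivity of `e^{-tJ}` gives a positive definite form, hence monic
orthogonal polynomials.

The deformation sits in the constant middle factor, so `w' = A w + w A^*` and `(J - xA) w = w (J -
xA)^*` hold for every `t`. Integration by parts makes `D` and `D^†` mutually adjoint for the
deformed weight itself, and the Casimir is symmetric. With operators acting from the right, the
second-order operator is `-D D^† - 2 (J - xA)`, hence symmetric too.

An operator that raises degrees by at most one and has an adjoint of the same kind reaches only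
`P_{n-1}, P_n, P_{n+1}` from `P_n` (`IsMonicMVOP.mem_rightFourier`). The second-order operator does
not raise degrees at all, so only `P_n` survives. The statements about `σ` are a separate
computation: conjugation by `e^{tJ/2}` fixes `J` and rescales `A`. -/

theorem constPoly_mul (A B : Matrix (Fin N) (Fin N) ℂ) :
    constPoly (A * B) = constPoly A * constPoly B := Matrix.map_mul

theorem constPoly_add (A B : Matrix (Fin N) (Fin N) ℂ) :
    constPoly (A + B) = constPoly A + constPoly B := map_add (C.mapMatrix) A B

theorem constPoly_sub (A B : Matrix (Fin N) (Fin N) ℂ) :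
    constPoly (A - B) = constPoly A - constPoly B := map_sub (C.mapMatrix) A B

theorem constPoly_zero : constPoly (0 : Matrix (Fin N) (Fin N) ℂ) = 0 :=
  map_zero (C.mapMatrix)

theorem constPoly_one : constPoly (1 : Matrix (Fin N) (Fin N) ℂ) = 1 :=
  map_one (C.mapMatrix)

theorem constPoly_smul (c : ℂ) (A : Matrix (Fin N) (Fin N) ℂ) :
    constPoly (c • A) = c • constPoly A := by
  ext1 i j
  simp [constPoly, Polynomial.smul_eq_C_mul]

theorem evalAt_mul (P Q : MatPoly N) (x : ℝ) : evalAt (P * Q) x = evalAt P x * evalAt Q x :=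
  map_mul ((evalRingHom (x : ℂ)).mapMatrix) P Q

theorem evalAt_sum {ι : Type*} (s : Finset ι) (f : ι → MatPoly N) (x : ℝ) :
    evalAt (∑ k ∈ s, f k) x = ∑ k ∈ s, evalAt (f k) x :=
  map_sum ((evalRingHom (x : ℂ)).mapMatrix) f s

theorem evalAt_constPoly (A : Matrix (Fin N) (Fin N) ℂ) (x : ℝ) : evalAt (constPoly A) x = A := by
  ext i j
  simp [evalAt, constPoly]

theorem evalAt_smul (p : ℂ[X]) (P : MatPoly N) (x : ℝ) :
    evalAt (p • P) x = p.eval (x : ℂ) • evalAt P x := by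
  ext i j
  simp [evalAt]

theorem toRat_mul (P Q : MatPoly N) : toRat (P * Q) = toRat P * toRat Q :=
  map_mul ((algebraMap ℂ[X] (RatFunc ℂ)).mapMatrix) P Q

theorem toRat_add (P Q : MatPoly N) : toRat (P + Q) = toRat P + toRat Q :=
  map_add ((algebraMap ℂ[X] (RatFunc ℂ)).mapMatrix) P Q

theorem toRat_sub (P Q : MatPoly N) : toRat (P - Q) = toRat P - toRat Q :=
  map_sub ((algebraMap ℂ[X] (RatFunc ℂ)).mapMatrix) P Q

theorem toRat_one : toRat (1 : MatPoly N) = 1 :=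
  map_one ((algebraMap ℂ[X] (RatFunc ℂ)).mapMatrix)

theorem toRat_smul (p : ℂ[X]) (P : MatPoly N) :
    toRat (p • P) = algebraMap ℂ[X] (RatFunc ℂ) p • toRat P := by
  ext i j
  simp [toRat]

/-- The entrywise derivative of a matrix polynomial. -/
def deriv (P : MatPoly N) : MatPoly N := P.map (fun p => derivative p)

theorem deriv_add (P Q : MatPoly N) : deriv (P + Q) = deriv P + deriv Q := by
  ext1 i j; simp [deriv]

theorem deriv_sum {ι : Type*} (s : Finset ι) (f : ι → MatPoly N) :
    deriv (∑ k ∈ s, f k) = ∑ k ∈ s, deriv (f k) := by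
  ext1 i j; simp [deriv, Matrix.sum_apply]

theorem deriv_mul (P Q : MatPoly N) : deriv (P * Q) = deriv P * Q + P * deriv Q := by
  ext1 i j
  simp [deriv, Matrix.mul_apply, Finset.sum_add_distrib]

theorem deriv_constPoly (A : Matrix (Fin N) (Fin N) ℂ) : deriv (constPoly A) = 0 := by
  ext1 i j; simp [deriv, constPoly]

theorem deriv_smul (p : ℂ[X]) (P : MatPoly N) :
    deriv (p • P) = derivative p • P + p • deriv P := by
  ext1 i j; simp [deriv]

/-- The adjoint of a matrix polynomial, for a real variable. -/
def pstar (P : MatPoly N) : MatPoly N := (P.map (Polynomial.map (starRingEnd ℂ)))ᵀ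

theorem pstar_mul (P Q : MatPoly N) : pstar (P * Q) = pstar Q * pstar P := by
  ext1 i j
  simp [pstar, Matrix.mul_apply, Polynomial.map_sum, mul_comm]

theorem pstar_add (P Q : MatPoly N) : pstar (P + Q) = pstar P + pstar Q := by
  ext1 i j; simp [pstar]

theorem pstar_sub (P Q : MatPoly N) : pstar (P - Q) = pstar P - pstar Q := by
  ext1 i j; simp [pstar]

theorem pstar_pstar (P : MatPoly N) : pstar (pstar P) = P := by
  ext1 i j; simp [pstar, Polynomial.map_map]

theorem pstar_constPoly (A : Matrix (Fin N) (Fin N) ℂ) : pstar (constPoly A) = constPoly Aᴴ := by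
  ext1 i j; simp [pstar, constPoly]

theorem pstar_X_smul (P : MatPoly N) : pstar ((X : ℂ[X]) • P) = (X : ℂ[X]) • pstar P := by
  ext1 i j; simp [pstar]

theorem pstar_deriv (P : MatPoly N) : pstar (deriv P) = deriv (pstar P) := by
  ext1 i j; simp [pstar, deriv, Polynomial.derivative_map]

theorem eval_map_conj (p : ℂ[X]) (x : ℝ) :
    (p.map (starRingEnd ℂ)).eval (x : ℂ) = star (p.eval (x : ℂ)) := by
  conv_lhs => rw [← Complex.conj_ofReal x]
  rw [Polynomial.eval_map_apply]
  rfl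

theorem evalAt_pstar (P : MatPoly N) (x : ℝ) : evalAt (pstar P) x = (evalAt P x)ᴴ := by
  ext i j
  simp [evalAt, pstar, eval_map_conj]

/-! ### The exponential of the nilpotent matrix -/

/-- Each factor `A` moves the support one subdiagonal down. Both nilpotency and the commutation with
`J` are read off from this. -/
theorem matA_pow_apply (a : Fin (N - 1) → ℂ) (k : ℕ) (i j : Fin N) (h : (i : ℕ) ≠ j + k) :
    (matA a ^ k) i j = 0 := by
  induction k generalizing i j with
  | zero => simp only [pow_zero]; exact Matrix.one_apply_ne fun e => h (by simp [e])
  | succ k ih =>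
    rw [pow_succ, Matrix.mul_apply]
    refine Finset.sum_eq_zero fun l _ => ?_
    by_cases hl : (i : ℕ) = l + k
    · have : ¬ ((j : ℕ) + 1 = l) := by omega
      simp [matA, this]
    · simp [ih i l hl]

theorem matA_pow_eq_zero (a : Fin (N - 1) → ℂ) {k : ℕ} (hk : N ≤ k) : matA a ^ k = 0 := by
  ext i j
  exact matA_pow_apply a k i j (by omega)

/-- On the `k`-th subdiagonal the diagonal entries of `J` in row and column differ by exactly `k`.
-/
theorem matJ_mul_matA_pow (a : Fin (N - 1) → ℂ) (k : ℕ) :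
    matJ N * matA a ^ k = matA a ^ k * matJ N + (k : ℂ) • matA a ^ k := by
  ext i j
  simp only [matJ, Matrix.diagonal_mul, Matrix.mul_diagonal, Matrix.add_apply, Matrix.smul_apply,
    smul_eq_mul]
  by_cases h : (i : ℕ) = j + k
  · rw [h]; push_cast; ring
  · simp [matA_pow_apply a k i j h]

/-- The polynomial `e^{xA}`. -/
def expPoly (a : Fin (N - 1) → ℂ) : MatPoly N :=
  ∑ k ∈ Finset.range N, (X ^ k : ℂ[X]) • constPoly ((k.factorial : ℂ)⁻¹ • matA a ^ k)

theorem evalAt_expPoly (a : Fin (N - 1) → ℂ) (x : ℝ) :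
    evalAt (expPoly a) x = NormedSpace.exp ((x : ℂ) • matA a) := by
  rw [congrFun (NormedSpace.exp_eq_tsum ℂ) _, tsum_eq_sum (s := Finset.range N), expPoly,
    evalAt_sum]
  · refine Finset.sum_congr rfl fun k _ => ?_
    rw [evalAt_smul, evalAt_constPoly, _root_.smul_pow, smul_comm]
    simp
  · intro k hk
    rw [_root_.smul_pow, matA_pow_eq_zero a (by simpa using hk)]
    simp

theorem deriv_expPoly (a : Fin (N - 1) → ℂ) :
    deriv (expPoly a) = constPoly (matA a) * expPoly a := by
  obtain _ | n := N
  · exact Subsingleton.elim _ _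
  -- The left sum loses its constant term and the right sum its top term, which contains `A ^ (n +
  -- 1) = 0`; the remaining terms match after a shift.
  rw [expPoly, deriv_sum, Finset.mul_sum, Finset.sum_range_succ', Finset.sum_range_succ]
  congr 1
  · refine Finset.sum_congr rfl fun k _ => ?_
    rw [deriv_smul, deriv_constPoly, smul_zero, add_zero, mul_smul_comm, ← constPoly_mul,
      mul_smul_comm, ← pow_succ', derivative_X_pow, Nat.factorial_succ, constPoly_smul,
      constPoly_smul, add_tsub_cancel_right, smul_comm, smul_comm (X ^ k : ℂ[X]), mul_comm,
      mul_smul]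
    have h (c : ℂ) (Y : MatPoly (n + 1)) : C c • Y = c • Y := by
      ext1 i j; simp [Polynomial.smul_eq_C_mul]
    have h0 : (k : ℂ) + 1 ≠ 0 := by exact_mod_cast k.succ_ne_zero
    rw [h, smul_smul]
    congr 1
    push_cast
    field_simp
  · rw [deriv_smul, deriv_constPoly, mul_smul_comm, ← constPoly_mul, mul_smul_comm, ← pow_succ',
      matA_pow_eq_zero a le_rfl]
    simp [constPoly_zero]

/-- Summing `[J, A^k] = k A^k` against `x^k / k!` gives `[J, e^{xA}] = x (e^{xA})'`, and the right
side is `xA e^{xA}`. -/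
theorem casimirPoly_mul_expPoly (a : Fin (N - 1) → ℂ) :
    casimirPoly a * expPoly a = expPoly a * constPoly (matJ N) := by
  have key : constPoly (matJ N) * expPoly a
      = expPoly a * constPoly (matJ N) + (X : ℂ[X]) • deriv (expPoly a) := by
    rw [expPoly, deriv_sum, Finset.mul_sum, Finset.sum_mul, Finset.smul_sum,
      ← Finset.sum_add_distrib]
    refine Finset.sum_congr rfl fun k _ => ?_
    rw [deriv_smul, deriv_constPoly, smul_zero, add_zero, mul_smul_comm, smul_mul_assoc,
      ← constPoly_mul, ← constPoly_mul, mul_smul_comm, matJ_mul_matA_pow, smul_add, constPoly_add,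
      smul_add, smul_mul_assoc]
    congr 1
    -- Splitting off `k = 0` avoids the truncated exponent `k - 1` in the derivative of `X ^ k`.
    obtain _ | k := k
    · simp [constPoly_zero]
    · rw [derivative_X_pow]
      ext1 i j
      simp [constPoly, pow_succ]
      ring
  rw [casimirPoly, sub_mul, key, deriv_expPoly, smul_mul_assoc]
  abel

theorem expJ_eq_diagonal (s : ℝ) :
    expJ N s = Matrix.diagonal fun i : Fin N => (Real.exp (s * ((i : ℕ) + 1)) : ℂ) := by
  rw [expJ, matJ, ← Matrix.diagonal_smul, Matrix.exp_diagonal]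
  congr 1
  ext i
  rw [Pi.coe_exp, ← Complex.exp_eq_exp_ℂ]
  simp

theorem evalAt_expPoly_isUnit (a : Fin (N - 1) → ℂ) (x : ℝ) : IsUnit (evalAt (expPoly a) x) := by
  rw [evalAt_expPoly]
  exact Matrix.isUnit_exp _

theorem exp_casimir_mul (a : Fin (N - 1) → ℂ) (t x : ℝ) :
    NormedSpace.exp (-(t : ℂ) • evalAt (casimirPoly a) x) * evalAt (expPoly a) x
      = evalAt (expPoly a) x * expJ N (-t) := by
  set U := evalAt (expPoly a) x with hU
  have hu : IsUnit U := evalAt_expPoly_isUnit a x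
  have hd : IsUnit U.det := (Matrix.isUnit_iff_isUnit_det _).1 hu
  have h : evalAt (casimirPoly a) x * U = U * matJ N := by
    rw [hU, ← evalAt_mul, casimirPoly_mul_expPoly, evalAt_mul, evalAt_constPoly]
  have h2 : -(t : ℂ) • evalAt (casimirPoly a) x = U * (-(t : ℂ) • matJ N) * U⁻¹ := by
    rw [mul_smul_comm, ← h, smul_mul_assoc, Matrix.mul_assoc, Matrix.mul_nonsing_inv _ hd,
      Matrix.mul_one]
  rw [h2, Matrix.exp_conj _ _ hu, Matrix.mul_assoc, Matrix.nonsing_inv_mul _ hd, Matrix.mul_one,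
    expJ]
  simp

/-- The polynomial part `e^{xA} e^{-tJ} e^{xA^*}` of the deformed weight. -/
def weightPoly (a : Fin (N - 1) → ℂ) (t : ℝ) : MatPoly N :=
  expPoly a * constPoly (expJ N (-t)) * pstar (expPoly a)

theorem deformedWeight_eq (a : Fin (N - 1) → ℂ) (t x : ℝ) :
    deformedWeight a t x = (Real.exp (-x ^ 2) : ℂ) • evalAt (weightPoly a t) x := by
  have h : NormedSpace.exp ((x : ℂ) • (matA a)ᴴ) = (evalAt (expPoly a) x)ᴴ := by
    rw [evalAt_expPoly, ← Matrix.exp_conjTranspose, Matrix.conjTranspose_smul]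
    simp
  rw [deformedWeight, weight, mul_smul_comm, h, ← evalAt_expPoly, ← Matrix.mul_assoc,
    exp_casimir_mul, weightPoly, evalAt_mul, evalAt_mul, evalAt_constPoly, evalAt_pstar]

/-- Makes the undeformed adjoint relation the case `t = 0` of the deformed one. -/
theorem weight_eq_deformedWeight (a : Fin (N - 1) → ℂ) : weight a = deformedWeight a 0 := by
  ext1 x
  simp [deformedWeight]

theorem expJ_conjTranspose (s : ℝ) : (expJ N s)ᴴ = expJ N s := by
  rw [expJ_eq_diagonal, Matrix.diagonal_conjTranspose]
  congr 1
  ext i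
  exact Complex.conj_ofReal _

theorem pstar_weightPoly (a : Fin (N - 1) → ℂ) (t : ℝ) :
    pstar (weightPoly a t) = weightPoly a t := by
  simp only [weightPoly, pstar_mul, pstar_pstar, pstar_constPoly, expJ_conjTranspose,
    Matrix.mul_assoc]

/-- The factor `e^{-tJ}` is constant in `x`, so only the outer exponentials are differentiated and
the equation does not see `t`. -/
theorem deriv_weightPoly (a : Fin (N - 1) → ℂ) (t : ℝ) :
    deriv (weightPoly a t)
      = constPoly (matA a) * weightPoly a t + weightPoly a t * constPoly (matA a)ᴴ := by
  simp only [weightPoly, deriv_mul, deriv_constPoly, ← pstar_deriv, deriv_expPoly, pstar_mul,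
    pstar_constPoly, Matrix.mul_assoc, zero_mul, zero_add]

/-- The Casimir becomes `J` on passing `e^{xA}`, commutes with `e^{-tJ}`, and becomes the adjoint
Casimir on passing `e^{xA^*}`. -/
theorem casimirPoly_mul_weightPoly (a : Fin (N - 1) → ℂ) (t : ℝ) :
    casimirPoly a * weightPoly a t = weightPoly a t * pstar (casimirPoly a) := by
  have hJ : (matJ N)ᴴ = matJ N := by
    rw [matJ, Matrix.diagonal_conjTranspose]
    congr 1
    ext i
    simp
  have hc : matJ N * expJ N (-t) = expJ N (-t) * matJ N := by
    rw [expJ_eq_diagonal, matJ, Matrix.diagonal_mul_diagonal, Matrix.diagonal_mul_diagonal]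
    simp only [mul_comm]
  have h := congrArg pstar (casimirPoly_mul_expPoly a)
  rw [pstar_mul, pstar_mul, pstar_constPoly, hJ] at h
  rw [weightPoly, Matrix.mul_assoc _ _ (pstar (casimirPoly a)), h, ← Matrix.mul_assoc,
    ← Matrix.mul_assoc, casimirPoly_mul_expPoly, Matrix.mul_assoc (expPoly a), ← constPoly_mul, hc,
    constPoly_mul, ← Matrix.mul_assoc, ← Matrix.mul_assoc]

end

section

/-! ### The Gaussian functional -/

theorem integrable_gauss_mul_eval (p : ℂ[X]) :
    Integrable fun x : ℝ => (Real.exp (-x ^ 2) : ℂ) * p.eval (x : ℂ) := by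
  induction p using Polynomial.induction_on' with
  | add p q hp hq => simp only [eval_add, mul_add]; exact hp.add hq
  | monomial n c =>
    have h := (integrable_rpow_mul_exp_neg_mul_sq one_pos
      (s := (n : ℝ)) (by have := n.cast_nonneg (α := ℝ); linarith)).ofReal (𝕜 := ℂ)
    refine (h.const_mul c).congr (Filter.Eventually.of_forall fun x => ?_)
    simp only [Real.rpow_natCast, eval_monomial, neg_mul, one_mul]
    rw [RCLike.ofReal_mul, RCLike.ofReal_pow]
    change c * ((x : ℂ) ^ n * (Real.exp (-x ^ 2) : ℂ)) = _
    ring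

/-- The functional `p ↦ ∫ e^{-x²} p(x) dx`. -/
def gaussInt : ℂ[X] →ₗ[ℂ] ℂ where
  toFun p := ∫ x : ℝ, (Real.exp (-x ^ 2) : ℂ) * p.eval (x : ℂ)
  map_add' p q := by
    rw [← integral_add (integrable_gauss_mul_eval p) (integrable_gauss_mul_eval q)]
    simp only [eval_add, mul_add]
  map_smul' c p := by
    rw [RingHom.id_apply, smul_eq_mul, ← integral_const_mul]
    congr 1
    ext x
    simp only [eval_smul, smul_eq_mul]
    ring

theorem gaussInt_apply (p : ℂ[X]) :
    gaussInt p = ∫ x : ℝ, (Real.exp (-x ^ 2) : ℂ) * p.eval (x : ℂ) := rfl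

/-- The integrand is the derivative of `e^{-x²} p`, which is integrable together with its
derivative: this is the integration by parts behind the adjoint relation. -/
theorem gaussInt_derivative (p : ℂ[X]) : gaussInt (derivative p - (2 * X) * p) = 0 := by
  rw [gaussInt_apply]
  refine integral_eq_zero_of_hasDerivAt_of_integrable
    (f := fun x : ℝ => (Real.exp (-x ^ 2) : ℂ) * p.eval (x : ℂ)) (fun x => ?_)
    (integrable_gauss_mul_eval _) (integrable_gauss_mul_eval p)
  have h1 : HasDerivAt (fun x : ℝ => p.eval (x : ℂ)) ((derivative p).eval (x : ℂ)) x :=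
    (p.hasDerivAt (x : ℂ)).comp_ofReal
  have h2 : HasDerivAt (fun x : ℝ => (Real.exp (-x ^ 2) : ℂ))
      ((Real.exp (-x ^ 2) * (-(2 * x)) : ℝ) : ℂ) x := by
    have := ((hasDerivAt_pow 2 x).neg.exp).ofReal_comp
    simpa using this
  refine (h2.mul h1).congr_deriv ?_
  simp only [eval_sub, eval_mul, eval_ofNat, eval_X]
  push_cast
  ring

theorem gaussInt_map_conj (p : ℂ[X]) :
    gaussInt (p.map (starRingEnd ℂ)) = star (gaussInt p) := by
  rw [gaussInt_apply, gaussInt_apply]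
  refine Eq.trans ?_ integral_conj
  congr 1
  ext x
  rw [eval_map_conj, map_mul, Complex.conj_ofReal]
  rfl

theorem gaussInt_mul_conj_pos {p : ℂ[X]} (hp : p ≠ 0) :
    0 < gaussInt (p * p.map (starRingEnd ℂ)) := by
  have h (x : ℝ) : (Real.exp (-x ^ 2) : ℂ) * (p * p.map (starRingEnd ℂ)).eval (x : ℂ)
      = ((Real.exp (-x ^ 2) * ‖p.eval (x : ℂ)‖ ^ 2 : ℝ) : ℂ) := by
    rw [eval_mul, eval_map_conj]
    have := Complex.mul_conj' (p.eval (x : ℂ))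
    change _ * (_ * (starRingEnd ℂ) _) = _
    rw [this]
    push_cast
    rfl
  have hi := integrable_gauss_mul_eval (p * p.map (starRingEnd ℂ))
  simp only [h] at hi
  have hi' : Integrable fun x : ℝ => Real.exp (-x ^ 2) * ‖p.eval (x : ℂ)‖ ^ 2 := by
    exact hi.re
  -- A polynomial vanishing on the whole real line has infinitely many roots.
  obtain ⟨x, hx⟩ : ∃ x : ℝ, p.eval (x : ℂ) ≠ 0 := by
    by_contra! hall
    refine hp (p.eq_zero_of_infinite_isRoot ?_)
    exact (Set.infinite_range_of_injective Complex.ofReal_injective).mono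
      (by rintro _ ⟨x, rfl⟩; exact hall x)
  rw [gaussInt_apply]
  simp only [h]
  rw [integral_complex_ofReal]
  refine Complex.zero_lt_real.2 ?_
  refine integral_pos_of_integrable_nonneg_nonzero (x := x) ?_ hi' (fun y => by positivity) ?_
  · have hc : Continuous fun x : ℝ => p.eval (x : ℂ) :=
      p.continuous.comp Complex.continuous_ofReal
    fun_prop
  · positivity

theorem map_gaussInt_constPoly_mul (M : Matrix (Fin N) (Fin N) ℂ) (P : MatPoly N) :
    (constPoly M * P).map gaussInt = M * P.map gaussInt := by
  ext i j
  simp [Matrix.mul_apply, constPoly, ← Polynomial.smul_eq_C_mul]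

theorem map_gaussInt_add (P Q : MatPoly N) :
    (P + Q).map gaussInt = P.map gaussInt + Q.map gaussInt := by
  ext i j; simp

theorem map_gaussInt_sub (P Q : MatPoly N) :
    (P - Q).map gaussInt = P.map gaussInt - Q.map gaussInt := by
  ext i j; simp

theorem map_gaussInt_pstar (P : MatPoly N) : (pstar P).map gaussInt = (P.map gaussInt)ᴴ := by
  ext i j
  simp [pstar, gaussInt_map_conj]

theorem map_gaussInt_deriv (P : MatPoly N) :
    (deriv P - (2 * X : ℂ[X]) • P).map gaussInt = 0 := by
  ext i j
  exact gaussInt_derivative (P i j)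

/-! ### The inner product of the deformed weight -/

variable (a : Fin (N - 1) → ℂ) (t : ℝ)

theorem matInner_eq (P Q : MatPoly N) :
    matInner (deformedWeight a t) P Q = (P * weightPoly a t * pstar Q).map gaussInt := by
  ext i j
  rw [matInner, Matrix.of_apply, Matrix.map_apply, gaussInt_apply]
  congr 1
  ext x
  rw [deformedWeight_eq, mul_smul_comm, smul_mul_assoc, ← evalAt_pstar, ← evalAt_mul,
    ← evalAt_mul]
  rfl

theorem matInner_constPoly_mul (M : Matrix (Fin N) (Fin N) ℂ) (P Q : MatPoly N) :
    matInner (deformedWeight a t) (constPoly M * P) Q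
      = M * matInner (deformedWeight a t) P Q := by
  rw [matInner_eq, matInner_eq, Matrix.mul_assoc, Matrix.mul_assoc, map_gaussInt_constPoly_mul,
    Matrix.mul_assoc]

theorem matInner_add_left (P P' Q : MatPoly N) :
    matInner (deformedWeight a t) (P + P') Q
      = matInner (deformedWeight a t) P Q + matInner (deformedWeight a t) P' Q := by
  simp only [matInner_eq, add_mul, map_gaussInt_add]

theorem matInner_sub_left (P P' Q : MatPoly N) :
    matInner (deformedWeight a t) (P - P') Q
      = matInner (deformedWeight a t) P Q - matInner (deformedWeight a t) P' Q := by
  simp only [matInner_eq, sub_mul, map_gaussInt_sub]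

theorem matInner_conjTranspose (P Q : MatPoly N) :
    (matInner (deformedWeight a t) P Q)ᴴ = matInner (deformedWeight a t) Q P := by
  rw [matInner_eq, matInner_eq, ← map_gaussInt_pstar, pstar_mul, pstar_mul, pstar_pstar,
    pstar_weightPoly, Matrix.mul_assoc]

theorem matInner_zero_left (Q : MatPoly N) : matInner (deformedWeight a t) 0 Q = 0 := by
  simpa using matInner_sub_left a t 0 0 Q

theorem matInner_sum_left {ι : Type*} (s : Finset ι) (f : ι → MatPoly N) (Q : MatPoly N) :
    matInner (deformedWeight a t) (∑ k ∈ s, f k) Q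
      = ∑ k ∈ s, matInner (deformedWeight a t) (f k) Q :=
  map_sum (AddMonoidHom.mk' (fun P => matInner (deformedWeight a t) P Q)
    fun P P' => matInner_add_left a t P P' Q) f s

theorem matInner_sum_right {ι : Type*} (s : Finset ι) (f : ι → MatPoly N) (P : MatPoly N) :
    matInner (deformedWeight a t) P (∑ k ∈ s, f k)
      = ∑ k ∈ s, matInner (deformedWeight a t) P (f k) := by
  rw [← matInner_conjTranspose, matInner_sum_left, Matrix.conjTranspose_sum]
  simp only [matInner_conjTranspose]

theorem matInner_mul_constPoly (M : Matrix (Fin N) (Fin N) ℂ) (P Q : MatPoly N) :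
    matInner (deformedWeight a t) P (constPoly M * Q)
      = matInner (deformedWeight a t) P Q * Mᴴ := by
  rw [← matInner_conjTranspose, matInner_constPoly_mul, Matrix.conjTranspose_mul,
    matInner_conjTranspose]

theorem det_expPoly_ne_zero : (expPoly a).det ≠ 0 := by
  intro h
  have h1 := (Matrix.isUnit_iff_isUnit_det _).1 (evalAt_expPoly_isUnit a 0)
  have h2 : (evalAt (expPoly a) 0).det = ((expPoly a).det).eval ((0 : ℝ) : ℂ) :=
    ((evalRingHom ((0 : ℝ) : ℂ)).map_det _).symm
  rw [h2, h, eval_zero] at h1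
  exact not_isUnit_zero h1

/-- With `V = R e^{xA}`, the entry is the sum over `k` of `e^{-t(k+1)} ∫ e^{-x²} |V_{ik}|²`. Row `i`
of `V` is nonzero because `e^{xA}` has nonzero determinant. Working row by row yields both
definiteness of the form and positive definite norms. -/
theorem matInner_self_diag_pos (R : MatPoly N) (i : Fin N) (hR : R i ≠ 0) :
    0 < matInner (deformedWeight a t) R R i i := by
  set V := R * expPoly a with hV
  have hrow : V i = R i ᵥ* expPoly a := Matrix.mul_apply_eq_vecMul R (expPoly a) i
  have hne : V i ≠ 0 := fun h => hR
    (Matrix.eq_zero_of_vecMul_eq_zero (det_expPoly_ne_zero a) (hrow ▸ h))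
  have e1 : R * weightPoly a t * pstar R = V * constPoly (expJ N (-t)) * pstar V := by
    rw [hV, weightPoly, pstar_mul]
    simp only [Matrix.mul_assoc]
  have e2 : matInner (deformedWeight a t) R R i i
      = ∑ k : Fin N, (Real.exp (-t * ((k : ℕ) + 1)) : ℂ)
        * gaussInt (V i k * (V i k).map (starRingEnd ℂ)) := by
    have e3 : constPoly (expJ N (-t)) = Matrix.diagonal
        fun k : Fin N => C (Real.exp (-t * ((k : ℕ) + 1)) : ℂ) := by
      rw [expJ_eq_diagonal, constPoly, Matrix.diagonal_map (map_zero _)]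
    rw [matInner_eq, e1, Matrix.map_apply, e3, Matrix.mul_apply, map_sum]
    refine Finset.sum_congr rfl fun k _ => ?_
    rw [Matrix.mul_diagonal, mul_comm (V i k), mul_assoc, ← Polynomial.smul_eq_C_mul, map_smul]
    rfl
  have hs (k : Fin N) : (0 : ℂ) < (Real.exp (-t * ((k : ℕ) + 1)) : ℂ) :=
    Complex.zero_lt_real.2 (Real.exp_pos _)
  obtain ⟨k, hk⟩ : ∃ k, V i k ≠ 0 := Function.ne_iff.1 hne
  rw [e2]
  refine Finset.sum_pos' (fun l _ => ?_) ⟨k, Finset.mem_univ _, ?_⟩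
  · by_cases hl : V i l = 0
    · simp [hl]
    · exact (mul_pos (hs l) (gaussInt_mul_conj_pos hl)).le
  · exact mul_pos (hs k) (gaussInt_mul_conj_pos hk)

theorem eq_zero_of_matInner_self_eq_zero (R : MatPoly N)
    (h : matInner (deformedWeight a t) R R = 0) : R = 0 := by
  ext1 i j
  by_contra hij
  have := matInner_self_diag_pos a t R i fun h0 => hij (congrFun h0 j)
  simp [h] at this

theorem matInner_self_posDef {n : ℕ} {P : MatPoly N} (hP : IsMonicOfDegree n P) :
    (matInner (deformedWeight a t) P P).PosDef := by
  refine Matrix.PosDef.of_dotProduct_mulVec_pos (matInner_conjTranspose a t P P) fun v hv => ?_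
  obtain ⟨i, hi⟩ : ∃ i, v i ≠ 0 := Function.ne_iff.1 hv
  -- Every row of `M` is `v^*`, so each diagonal entry of `M ⟨P, P⟩ M^*` is `v^* ⟨P, P⟩ v`. Row `i`
  -- of `M P` is nonzero: its `i`-th entry has `x^n` coefficient `star (v i)`.
  set M : Matrix (Fin N) (Fin N) ℂ := Matrix.of fun _ j => star (v j) with hM
  have hrow : (constPoly M * P) i ≠ 0 := by
    intro h0
    have h1 := congrArg (fun p => Polynomial.coeff p n) (congrFun h0 i)
    simp [Matrix.mul_apply, constPoly, hM, (hP _ _).1, Matrix.one_apply, hi] at h1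
  have h := matInner_self_diag_pos a t (constPoly M * P) i hrow
  rw [matInner_constPoly_mul, matInner_mul_constPoly] at h
  convert h using 1
  rw [← Matrix.mul_assoc, Matrix.mul_assoc, Matrix.mul_apply]
  simp [dotProduct, hM, Matrix.mulVec, Matrix.mul_apply]

end

section

/-! ### The operators as maps on matrix polynomials -/

theorem act_add (P : MatPoly N) (E F : DiffOp N) : act P (E + F) = act P E + act P F :=
  Finsupp.sum_add_index' (by simp) (by intros; rw [mul_add])

theorem act_single (P : MatPoly N) (j : ℕ) (F : Matrix (Fin N) (Fin N) (RatFunc ℂ)) :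
    act P (Finsupp.single j F) = toRat (P.map fun p => derivative^[j] p) * F :=
  Finsupp.sum_single_index (by simp)

theorem act_neg (P : MatPoly N) (E : DiffOp N) : act P (-E) = -act P E := by
  have h : act P (0 : DiffOp N) = 0 := Finsupp.sum_zero_index
  have h' := act_add P (-E) E
  rw [neg_add_cancel, h] at h'
  exact eq_neg_of_add_eq_zero_left h'.symm

variable (a : Fin (N - 1) → ℂ)

/-- The action of `D^{(a)}`. -/
def mapD (P : MatPoly N) : MatPoly N := deriv P + P * constPoly (matA a)

/-- The action of `(D^{(a)})^†`. -/
def mapDdag (P : MatPoly N) : MatPoly N := (2 * X : ℂ[X]) • P - mapD a P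

/-- The action of the second-order operator. -/
def mapSecond (P : MatPoly N) : MatPoly N :=
  deriv (deriv P) + ((2 : ℂ[X]) • (deriv P * constPoly (matA a)) - (2 * X : ℂ[X]) • deriv P)
    + P * constPoly (matA a ^ 2 - (2 : ℂ) • matJ N)

theorem act_opD (P : MatPoly N) : act P (opD a) = toRat (mapD a P) := by
  rw [opD, act_add, act_single, act_single, mapD, toRat_add, toRat_mul, Matrix.mul_one]
  congr 2

theorem toRat_two_X_smul (P : MatPoly N) :
    toRat ((2 * X : ℂ[X]) • P) = toRat P * ((2 * RatFunc.X : RatFunc ℂ) • 1) := by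
  rw [toRat_smul, mul_smul_comm, Matrix.mul_one, map_mul,
    map_ofNat, RatFunc.algebraMap_X]

theorem act_opDdag (P : MatPoly N) : act P (opDdag a) = toRat (mapDdag a P) := by
  rw [opDdag, act_add, act_neg, act_opD, act_single, mapDdag, toRat_sub, toRat_two_X_smul,
    neg_add_eq_sub]
  congr 3

theorem act_opSecond (P : MatPoly N) : act P (opSecond a) = toRat (mapSecond a P) := by
  rw [opSecond, act_add, act_add, act_single, act_single, act_single, mapSecond, toRat_add,
    toRat_add, toRat_sub, toRat_two_X_smul, toRat_smul, toRat_mul, toRat_mul, Matrix.mul_sub,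
    mul_smul_comm, Matrix.mul_one]
  have h0 : (P.map fun p => derivative^[0] p) = P := by ext1 i j; simp
  have h1 : (P.map fun p => derivative^[1] p) = deriv P := by ext1 i j; simp [deriv]
  have h2 : (P.map fun p => derivative^[2] p) = deriv (deriv P) := by ext1 i j; simp [deriv]
  rw [h0, h1, h2, map_ofNat]
  rfl

theorem act_opCasimir (P : MatPoly N) : act P (opCasimir a) = toRat (P * casimirPoly a) := by
  rw [opCasimir, act_single, toRat_mul]
  congr 2

/-- The term `2x P A` produced by `D D^†` cancels against the one in the Casimir. This factorization
is the source of the symmetry. -/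
theorem mapSecond_eq (P : MatPoly N) :
    mapSecond a P = -mapDdag a (mapD a P) - (P * casimirPoly a + P * casimirPoly a) := by
  simp only [mapSecond, mapDdag, mapD, casimirPoly, deriv_add, deriv_mul, deriv_constPoly,
    constPoly_sub, constPoly_mul, pow_two, two_smul, constPoly_add, mul_smul_comm, add_mul,
    smul_add, mul_add, mul_sub, mul_zero, mul_smul, Matrix.mul_assoc]
  abel

/-! ### Adjoint relations for the deformed weight -/

variable (t : ℝ)

/-- The difference of the two integrands is `(P w Q^*)' - 2x P w Q^*`: the terms with `A` and `A^*`
are those of `w'`. -/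
theorem matInner_mapD (P Q : MatPoly N) :
    matInner (deformedWeight a t) (mapD a P) Q
      = matInner (deformedWeight a t) P (mapDdag a Q) := by
  rw [← sub_eq_zero, matInner_eq, matInner_eq, ← map_gaussInt_sub]
  refine Eq.trans ?_ (map_gaussInt_deriv (P * weightPoly a t * pstar Q))
  congr 1
  simp only [mapDdag, mapD, pstar_sub, pstar_add, pstar_mul, pstar_deriv, pstar_constPoly,
    mul_smul, two_smul, pstar_X_smul, deriv_mul, deriv_weightPoly, add_mul, mul_add, mul_sub,
    mul_smul_comm, Matrix.mul_assoc]
  abel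

theorem matInner_mapDdag (P Q : MatPoly N) :
    matInner (deformedWeight a t) (mapDdag a P) Q
      = matInner (deformedWeight a t) P (mapD a Q) := by
  rw [← matInner_conjTranspose, ← matInner_mapD, matInner_conjTranspose]

theorem matInner_mul_casimirPoly (P Q : MatPoly N) :
    matInner (deformedWeight a t) (P * casimirPoly a) Q
      = matInner (deformedWeight a t) P (Q * casimirPoly a) := by
  rw [matInner_eq, matInner_eq, pstar_mul, Matrix.mul_assoc P, casimirPoly_mul_weightPoly]
  simp only [Matrix.mul_assoc]

theorem matInner_mapSecond (P Q : MatPoly N) :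
    matInner (deformedWeight a t) (mapSecond a P) Q
      = matInner (deformedWeight a t) P (mapSecond a Q) := by
  -- In this form, exchanging `P` and `Q` and taking the conjugate transpose visibly changes
  -- nothing, by symmetry of the Casimir.
  have h (P Q : MatPoly N) : matInner (deformedWeight a t) (mapSecond a P) Q
      = -matInner (deformedWeight a t) (mapD a P) (mapD a Q)
        - (matInner (deformedWeight a t) (P * casimirPoly a) Q
          + matInner (deformedWeight a t) (P * casimirPoly a) Q) := by
    rw [mapSecond_eq, matInner_sub_left, matInner_add_left, ← zero_sub (mapDdag a _),
      matInner_sub_left, matInner_zero_left, zero_sub, matInner_mapDdag]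
  rw [← matInner_conjTranspose _ _ (mapSecond a Q), h, h]
  simp only [Matrix.conjTranspose_sub, Matrix.conjTranspose_add, Matrix.conjTranspose_neg,
    matInner_conjTranspose, matInner_mul_casimirPoly]

/-! ### Degrees -/

/-- All entries of `P` have degree less than `n`. -/
def DegLT (n : ℕ) (P : MatPoly N) : Prop := ∀ i j m, n ≤ m → (P i j).coeff m = 0

variable {a} {n : ℕ} {P Q : MatPoly N}

theorem DegLT.mono {m : ℕ} (h : DegLT n P) (hnm : n ≤ m) : DegLT m P :=
  fun i j k hk => h i j k (hnm.trans hk)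

theorem DegLT.add (hP : DegLT n P) (hQ : DegLT n Q) : DegLT n (P + Q) := fun i j m hm => by
  simp [hP i j m hm, hQ i j m hm]

theorem DegLT.sub (hP : DegLT n P) (hQ : DegLT n Q) : DegLT n (P - Q) := fun i j m hm => by
  simp [hP i j m hm, hQ i j m hm]

theorem DegLT.mul_constPoly (hP : DegLT n P) (M : Matrix (Fin N) (Fin N) ℂ) :
    DegLT n (P * constPoly M) := fun i j m hm => by
  simp [Matrix.mul_apply, constPoly, hP i _ m hm]

theorem DegLT.constPoly_mul (hP : DegLT n P) (M : Matrix (Fin N) (Fin N) ℂ) :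
    DegLT n (constPoly M * P) := fun i j m hm => by
  simp [Matrix.mul_apply, constPoly, hP _ j m hm]

theorem DegLT.deriv (hP : DegLT (n + 1) P) : DegLT n (deriv P) := fun i j m hm => by
  simp [MatrixHermite.deriv, coeff_derivative, hP i j (m + 1) (by omega)]

theorem DegLT.X_smul (hP : DegLT n P) : DegLT (n + 1) ((X : ℂ[X]) • P) := fun i j m hm => by
  obtain ⟨m, rfl⟩ : ∃ k, m = k + 1 := ⟨m - 1, by omega⟩
  simp [coeff_X_mul, hP i j m (by omega)]

theorem DegLT.two_X_smul (hP : DegLT n P) : DegLT (n + 1) ((2 * X : ℂ[X]) • P) := by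
  rw [mul_smul, two_smul]
  exact hP.X_smul.add hP.X_smul

theorem IsMonicOfDegree.degLT (hP : IsMonicOfDegree n P) : DegLT (n + 1) P :=
  fun i j m hm => (hP i j).2 m hm

theorem DegLT.mapD (hP : DegLT n P) : DegLT n (mapD a P) :=
  ((hP.mono n.le_succ).deriv).add (hP.mul_constPoly _)

theorem DegLT.mapDdag (hP : DegLT n P) : DegLT (n + 1) (mapDdag a P) :=
  hP.two_X_smul.sub (hP.mapD.mono n.le_succ)

theorem DegLT.mul_casimirPoly (hP : DegLT n P) : DegLT (n + 1) (P * casimirPoly a) := by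
  rw [casimirPoly, mul_sub, mul_smul_comm]
  exact ((hP.mul_constPoly _).mono n.le_succ).sub (hP.mul_constPoly _).X_smul

/-- The only factor `x` multiplies a first derivative, so the degree lost is at most regained. -/
theorem DegLT.mapSecond (hP : DegLT (n + 1) P) : DegLT (n + 1) (mapSecond a P) := by
  refine (((hP.deriv.mono n.le_succ).mono n.succ.le_succ).deriv.add (DegLT.sub ?_ ?_)).add
    (hP.mul_constPoly _)
  · rw [two_smul]
    exact ((hP.deriv.mul_constPoly _).add (hP.deriv.mul_constPoly _)).mono n.le_succ
  · exact hP.deriv.two_X_smul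

end

section

/-! ### Existence of the orthogonal polynomials -/

theorem coeff_X_pow_smul_one (k m : ℕ) (i j : Fin N) :
    (((X ^ k : ℂ[X]) • (1 : MatPoly N)) i j).coeff m
      = if m = k then (1 : Matrix (Fin N) (Fin N) ℂ) i j else 0 := by
  by_cases h : i = j
  · subst h
    simp [coeff_X_pow]
  · simp [h]

theorem coeff_constPoly_mul_X_pow (M : Matrix (Fin N) (Fin N) ℂ) (k m : ℕ) (i j : Fin N) :
    ((constPoly M * ((X ^ k : ℂ[X]) • (1 : MatPoly N))) i j).coeff m
      = if m = k then M i j else 0 := by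
  rw [mul_smul_comm, Matrix.mul_one, Matrix.smul_apply, smul_eq_mul, mul_comm, constPoly,
    Matrix.map_apply, coeff_C_mul, coeff_X_pow]
  simp

/-- The matrix polynomial with coefficients `M k`, `k < n`. -/
def ofCoeffs {n : ℕ} (M : Fin n → Matrix (Fin N) (Fin N) ℂ) : MatPoly N :=
  ∑ k, constPoly (M k) * ((X ^ (k : ℕ) : ℂ[X]) • (1 : MatPoly N))

theorem coeff_ofCoeffs {n : ℕ} (M : Fin n → Matrix (Fin N) (Fin N) ℂ) (m : ℕ) (i j : Fin N) :
    (ofCoeffs M i j).coeff m = if h : m < n then M ⟨m, h⟩ i j else 0 := by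
  rw [ofCoeffs, Matrix.sum_apply, finsetSum_coeff]
  simp only [coeff_constPoly_mul_X_pow]
  split_ifs with h
  · rw [Finset.sum_eq_single ⟨m, h⟩]
    · simp
    · intro k _ hk
      exact if_neg fun e => hk (Fin.ext e.symm)
    · simp
  · exact Finset.sum_eq_zero fun k _ => if_neg (by omega)

theorem degLT_ofCoeffs {n : ℕ} (M : Fin n → Matrix (Fin N) (Fin N) ℂ) : DegLT n (ofCoeffs M) :=
  fun i j m hm => by rw [coeff_ofCoeffs, dif_neg (by omega)]

theorem DegLT.exists_ofCoeffs {n : ℕ} {Q : MatPoly N} (hQ : DegLT n Q) :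
    ∃ M : Fin n → Matrix (Fin N) (Fin N) ℂ, Q = ofCoeffs M := by
  refine ⟨fun k => Matrix.of fun i j => (Q i j).coeff k, ?_⟩
  ext i j m
  rw [coeff_ofCoeffs]
  split_ifs with h
  · rfl
  · exact hQ i j m (by omega)

variable (a : Fin (N - 1) → ℂ) (t : ℝ)

theorem matInner_eq_zero_of_degLT {n : ℕ} {P Q : MatPoly N}
    (h : ∀ k < n, matInner (deformedWeight a t) P ((X ^ k : ℂ[X]) • (1 : MatPoly N)) = 0)
    (hQ : DegLT n Q) : matInner (deformedWeight a t) P Q = 0 := by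
  obtain ⟨M, rfl⟩ := hQ.exists_ofCoeffs
  rw [ofCoeffs, matInner_sum_right]
  exact Finset.sum_eq_zero fun k _ => by rw [matInner_mul_constPoly, h k k.2, zero_mul]

/-- The Gram map on polynomials of degree below `n` is injective by definiteness, hence surjective
in finite dimension. So `x^n` has an orthogonal projection, which is subtracted. -/
theorem exists_monic_orthogonal (n : ℕ) : ∃ P : MatPoly N, IsMonicOfDegree n P ∧
    ∀ Q, DegLT n Q → matInner (deformedWeight a t) P Q = 0 := by
  let T : (Fin n → Matrix (Fin N) (Fin N) ℂ) →ₗ[ℂ] (Fin n → Matrix (Fin N) (Fin N) ℂ) :=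
    { toFun := fun M j => matInner (deformedWeight a t) (ofCoeffs M)
        ((X ^ (j : ℕ) : ℂ[X]) • (1 : MatPoly N))
      map_add' := fun M M' => by
        ext1 j
        simp only [ofCoeffs, matInner_sum_left, matInner_constPoly_mul, Pi.add_apply, add_mul,
          Finset.sum_add_distrib]
      map_smul' := fun c M => by
        ext1 j
        simp only [ofCoeffs, matInner_sum_left, matInner_constPoly_mul, Pi.smul_apply,
          smul_mul_assoc, Finset.smul_sum, RingHom.id_apply] }
  have hT : Function.Injective T := by
    refine (injective_iff_map_eq_zero T).2 fun M hM => ?_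
    have h0 : ofCoeffs M = 0 := eq_zero_of_matInner_self_eq_zero a t _
      (matInner_eq_zero_of_degLT a t (fun k hk => congrFun hM ⟨k, hk⟩) (degLT_ofCoeffs M))
    ext k i j
    have h1 := coeff_ofCoeffs M k i j
    rw [h0] at h1
    simpa using h1.symm
  obtain ⟨M, hM⟩ := LinearMap.injective_iff_surjective.1 hT fun j =>
    matInner (deformedWeight a t) ((X ^ n : ℂ[X]) • (1 : MatPoly N))
      ((X ^ (j : ℕ) : ℂ[X]) • (1 : MatPoly N))
  refine ⟨(X ^ n : ℂ[X]) • (1 : MatPoly N) - ofCoeffs M, fun i j => ⟨?_, fun m hm => ?_⟩,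
    fun Q hQ => matInner_eq_zero_of_degLT a t (fun k hk => ?_) hQ⟩
  · rw [Matrix.sub_apply, coeff_sub, coeff_X_pow_smul_one, degLT_ofCoeffs M i j n le_rfl]
    simp
  · rw [Matrix.sub_apply, coeff_sub, coeff_X_pow_smul_one, degLT_ofCoeffs M i j m hm.le,
      if_neg hm.ne', sub_zero]
  · rw [matInner_sub_left, sub_eq_zero]
    exact (congrFun hM ⟨k, hk⟩).symm

theorem exists_isMonicMVOP : ∃ P : ℕ → MatPoly N, IsMonicMVOP (deformedWeight a t) P := by
  choose P hP ho using exists_monic_orthogonal a t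
  refine ⟨P, hP, fun n m hnm => ?_, fun n => matInner_self_posDef a t (hP n)⟩
  obtain h | h := hnm.lt_or_gt
  · rw [← matInner_conjTranspose, ho m _ ((hP n).degLT.mono h), Matrix.conjTranspose_zero]
  · exact ho n _ ((hP m).degLT.mono h)

/-! ### Expansions in orthogonal polynomials -/

theorem DegLT.exists_expansion {P : ℕ → MatPoly N} (hP : ∀ n, IsMonicOfDegree n (P n)) {n : ℕ}
    {Q : MatPoly N} (hQ : DegLT n Q) : ∃ c : ℕ → Matrix (Fin N) (Fin N) ℂ,
      Q = ∑ m ∈ Finset.range n, constPoly (c m) * P m := by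
  induction n generalizing Q with
  | zero =>
    refine ⟨0, ?_⟩
    ext i j m
    simpa using hQ i j m m.zero_le
  | succ n ih =>
    set M : Matrix (Fin N) (Fin N) ℂ := Matrix.of fun i j => (Q i j).coeff n with hM
    have h : DegLT n (Q - constPoly M * P n) := by
      intro i j m hm
      obtain rfl | hm := hm.eq_or_lt
      · simp [Matrix.mul_apply, constPoly, ((hP n) _ _).1, Matrix.one_apply, hM]
      · exact hQ.sub ((hP n).degLT.constPoly_mul M) i j m hm
    obtain ⟨c, hc⟩ := ih h
    refine ⟨Function.update c n M, ?_⟩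
    rw [Finset.sum_range_succ, Function.update_self, ← sub_eq_iff_eq_add, hc]
    refine Finset.sum_congr rfl fun m hm => ?_
    rw [Function.update_of_ne (Finset.mem_range.1 hm).ne]

variable {a t} {P : ℕ → MatPoly N}

theorem IsMonicMVOP.matInner_eq_zero (hP : IsMonicMVOP (deformedWeight a t) P) {n : ℕ}
    {Q : MatPoly N} (hQ : DegLT n Q) : matInner (deformedWeight a t) (P n) Q = 0 := by
  obtain ⟨c, rfl⟩ := hQ.exists_expansion hP.monic
  rw [matInner_sum_right]
  refine Finset.sum_eq_zero fun m hm => ?_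
  rw [matInner_mul_constPoly, hP.orthogonal n m (Finset.mem_range.1 hm).ne', zero_mul]

/-- Only the terms with nonzero inner product contribute to the expansion. -/
theorem IsMonicMVOP.exists_expansion (hP : IsMonicMVOP (deformedWeight a t) P) {n : ℕ}
    {Q : MatPoly N} (hQ : DegLT n Q) : ∃ c : ℕ → Matrix (Fin N) (Fin N) ℂ,
      Q = ∑ m ∈ Finset.range n, constPoly (c m) * P m ∧
      ∀ m < n, matInner (deformedWeight a t) Q (P m) = 0 → c m = 0 := by
  obtain ⟨c, hc⟩ := hQ.exists_expansion hP.monic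
  refine ⟨c, hc, fun m hm h0 => ?_⟩
  rw [hc, matInner_sum_left, Finset.sum_eq_single m] at h0
  · rw [matInner_constPoly_mul] at h0
    exact (hP.posDef m).isUnit.mul_left_eq_zero.1 h0
  · intro k _ hk
    rw [matInner_constPoly_mul, hP.orthogonal k m hk, mul_zero]
  · exact fun h => absurd (Finset.mem_range.2 hm) h

theorem shiftAct_add (M M' : DiffceOp N) (P : ℕ → MatPoly N) (n : ℕ) :
    shiftAct (M + M') P n = shiftAct M P n + shiftAct M' P n :=
  Finsupp.sum_add_index' (by simp [constPoly_zero])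
    (by intros; rw [Pi.add_apply, constPoly_add, add_mul])

theorem shiftAct_single (j : ℤ) (G : ℕ → Matrix (Fin N) (Fin N) ℂ) (P : ℕ → MatPoly N) (n : ℕ) :
    shiftAct (Finsupp.single j G) P n = constPoly (G n) * extZero P (n + j) :=
  Finsupp.sum_single_index (by simp [constPoly_zero])

/-- Operators that raise degrees by at most one and have an adjoint with the same property act on
the orthogonal polynomials through a three-term difference operator. -/
theorem IsMonicMVOP.mem_rightFourier (hP : IsMonicMVOP (deformedWeight a t) P) {E : DiffOp N}
    {S T : MatPoly N → MatPoly N} (hE : ∀ Q, act Q E = toRat (S Q))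
    (hS : ∀ n Q, DegLT (n + 1) Q → DegLT (n + 2) (S Q))
    (hT : ∀ n Q, DegLT (n + 1) Q → DegLT (n + 2) (T Q))
    (hST : ∀ Q R, matInner (deformedWeight a t) (S Q) R = matInner (deformedWeight a t) Q (T R)) :
    E ∈ rightFourier P := by
  have key (n : ℕ) := hP.exists_expansion (hS n _ (hP.monic n).degLT)
  choose c hc hc0 using key
  -- The adjoint moves the operator onto `P m`, giving degree at most `m + 1 < n`, which is
  -- orthogonal to `P n`.
  have hlow (n m : ℕ) (h : m + 1 < n) : c n m = 0 := by
    refine hc0 n m (by omega) ?_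
    rw [hST]
    exact hP.matInner_eq_zero ((hT m _ (hP.monic m).degLT).mono h)
  -- At `n = 0` the truncated index `n - 1` is harmless: its coefficient multiplies the zero
  -- polynomial in position `-1`.
  refine ⟨Finsupp.single (-1) (fun n => c n (n - 1)) + Finsupp.single 0 (fun n => c n n)
    + Finsupp.single 1 (fun n => c n (n + 1)), fun n => ?_⟩
  have ext_natCast (m : ℕ) : extZero P (m : ℤ) = P m := by simp [extZero]
  have h1 : extZero P ((n : ℤ) + 1) = P (n + 1) := by exact_mod_cast ext_natCast (n + 1)
  rw [hE, hc n, shiftAct_add, shiftAct_add, shiftAct_single, shiftAct_single, shiftAct_single,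
    add_zero, ext_natCast, h1, Finset.sum_range_succ, Finset.sum_range_succ]
  congr 3
  obtain _ | n := n
  · simp [extZero]
  · rw [Finset.sum_range_succ, Finset.sum_eq_zero fun m hm => ?_, zero_add, Nat.add_sub_cancel]
    · congr 1
      rw [← ext_natCast n]
      congr 1
      push_cast
      ring
    · rw [hlow _ m (by simpa using hm), constPoly_zero, zero_mul]

/-- Degree preservation excludes components along `P m` with `m > n`; symmetry together with degree
preservation on `P m` excludes those with `m < n`. -/
theorem IsMonicMVOP.exists_eigenvalue (hP : IsMonicMVOP (deformedWeight a t) P) (n : ℕ) :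
    ∃ Γ : Matrix (Fin N) (Fin N) ℂ, mapSecond a (P n) = constPoly Γ * P n := by
  obtain ⟨c, hc, hc0⟩ := hP.exists_expansion ((hP.monic n).degLT.mapSecond (a := a))
  refine ⟨c n, ?_⟩
  rw [hc, Finset.sum_range_succ, Finset.sum_eq_zero fun m hm => ?_, zero_add]
  have hm := Finset.mem_range.1 hm
  rw [hc0 m (by omega) ?_, constPoly_zero, zero_mul]
  rw [matInner_mapSecond]
  exact hP.matInner_eq_zero ((hP.monic m).degLT.mapSecond.mono hm)

/-! ### The map `σ` -/

theorem sigma_add (t : ℝ) (E F : DiffOp N) : sigma t (E + F) = sigma t E + sigma t F :=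
  Finsupp.mapRange_add (by intros; rw [mul_add, add_mul]) E F

theorem sigma_neg (t : ℝ) (E : DiffOp N) : sigma t (-E) = -sigma t E :=
  Finsupp.mapRange_neg (by intros; rw [mul_neg, neg_mul]) E

theorem sigma_single (t : ℝ) (j : ℕ) (F : Matrix (Fin N) (Fin N) (RatFunc ℂ)) :
    sigma t (Finsupp.single j F) = Finsupp.single j
      (constRat (expJ N (-(t / 2))) * F * constRat (expJ N (t / 2))) :=
  Finsupp.mapRange_single

theorem constRat_mul (A B : Matrix (Fin N) (Fin N) ℂ) :
    constRat (A * B) = constRat A * constRat B := by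
  rw [constRat, constPoly_mul, toRat_mul]; rfl

theorem expJ_neg_mul_expJ (s : ℝ) : expJ N (-s) * expJ N s = 1 := by
  rw [expJ_eq_diagonal, expJ_eq_diagonal, Matrix.diagonal_mul_diagonal, ← Matrix.diagonal_one]
  congr 1
  ext i
  rw [← Complex.ofReal_mul, ← Real.exp_add]
  simp

theorem expJ_conj_matJ (s : ℝ) : expJ N (-s) * matJ N * expJ N s = matJ N := by
  have hc : expJ N (-s) * matJ N = matJ N * expJ N (-s) := by
    rw [expJ_eq_diagonal, matJ, Matrix.diagonal_mul_diagonal, Matrix.diagonal_mul_diagonal]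
    simp only [mul_comm]
  rw [hc, Matrix.mul_assoc, expJ_neg_mul_expJ, Matrix.mul_one]

/-- Conjugation multiplies the first subdiagonal by `e^{-t/2}`, which cancels the scaling of the
parameters. -/
theorem expJ_conj_matA (t : ℝ) (a : Fin (N - 1) → ℂ) :
    expJ N (-(t / 2)) * matA (scaled t a) * expJ N (t / 2) = matA a := by
  ext i j
  rw [expJ_eq_diagonal, expJ_eq_diagonal, Matrix.mul_diagonal, Matrix.diagonal_mul]
  simp only [matA, scaled, Matrix.of_apply]
  split_ifs with h
  · have e : Real.exp (-(t / 2) * ((i : ℕ) + 1)) * Real.exp (t / 2)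
        * Real.exp (t / 2 * ((j : ℕ) + 1)) = 1 := by
      rw [← Real.exp_add, ← Real.exp_add, Real.exp_eq_one_iff, ← h]
      push_cast
      ring
    have e' : (Real.exp (-(t / 2) * ((i : ℕ) + 1)) : ℂ) * (Real.exp (t / 2) : ℂ)
        * (Real.exp (t / 2 * ((j : ℕ) + 1)) : ℂ) = 1 := by exact_mod_cast e
    linear_combination (a ⟨j, by omega⟩) * e'
  · simp

theorem expJ_conj_sq_sub (t : ℝ) (a : Fin (N - 1) → ℂ) :
    expJ N (-(t / 2)) * (matA (scaled t a) ^ 2 - (2 : ℂ) • matJ N) * expJ N (t / 2)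
      = matA a ^ 2 - (2 : ℂ) • matJ N := by
  have h := expJ_neg_mul_expJ (N := N) (-(t / 2))
  rw [neg_neg] at h
  have e : expJ N (-(t / 2)) * matA (scaled t a) ^ 2 * expJ N (t / 2) = matA a ^ 2 := by
    -- The square of the conjugate is the conjugate of the square, as the inner factors `e^{tJ/2}
    -- e^{-tJ/2}` cancel.
    conv_rhs => rw [← expJ_conj_matA t a, pow_two]
    rw [pow_two, Matrix.mul_assoc (_ * _) (expJ N (t / 2)), ← Matrix.mul_assoc (expJ N (t / 2)),
      ← Matrix.mul_assoc (expJ N (t / 2)), h, Matrix.one_mul]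
    simp only [Matrix.mul_assoc]
  rw [mul_sub, sub_mul, e, mul_smul_comm, smul_mul_assoc, expJ_conj_matJ]

theorem constRat_conj_smul_one (t : ℝ) (f : RatFunc ℂ) :
    constRat (expJ N (-(t / 2))) * (f • 1) * constRat (expJ N (t / 2)) = f • 1 := by
  rw [mul_smul_comm, smul_mul_assoc, Matrix.mul_one, ← constRat_mul, expJ_neg_mul_expJ, constRat,
    constPoly_one, toRat_one]

theorem constRat_conj_one (t : ℝ) :
    constRat (expJ N (-(t / 2))) * 1 * constRat (expJ N (t / 2)) = 1 := by
  simpa using constRat_conj_smul_one (N := N) t 1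

theorem sigma_opD (t : ℝ) (a : Fin (N - 1) → ℂ) : sigma t (opD (scaled t a)) = opD a := by
  rw [opD, sigma_add, sigma_single, sigma_single, constRat_conj_one, ← constRat_mul,
    ← constRat_mul, expJ_conj_matA, opD]

theorem sigma_opDdag (t : ℝ) (a : Fin (N - 1) → ℂ) :
    sigma t (opDdag (scaled t a)) = opDdag a := by
  rw [opDdag, sigma_add, sigma_neg, sigma_opD, sigma_single, constRat_conj_smul_one, opDdag]

theorem sigma_opSecond (t : ℝ) (a : Fin (N - 1) → ℂ) :
    sigma t (opSecond (scaled t a)) = opSecond a := by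
  rw [opSecond, sigma_add, sigma_add, sigma_single, sigma_single, sigma_single, constRat_conj_one,
    mul_sub, sub_mul, constRat_conj_smul_one, mul_smul_comm, smul_mul_assoc, ← constRat_mul,
    ← constRat_mul, ← constRat_mul, ← constRat_mul, expJ_conj_matA, expJ_conj_sq_sub, opSecond]

theorem sigma_opCasimir (t : ℝ) (a : Fin (N - 1) → ℂ) :
    sigma t (opCasimir (scaled t a)) = opCasimir a := by
  rw [opCasimir, sigma_single, opCasimir, constRat, constRat, ← toRat_mul, ← toRat_mul,
    casimirPoly, mul_sub, sub_mul, mul_smul_comm, smul_mul_assoc, ← constPoly_mul,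
    ← constPoly_mul, ← constPoly_mul, ← constPoly_mul, expJ_conj_matA, expJ_conj_matJ, casimirPoly]

end

end MatrixHermite

end

theorem corollary19 (N : ℕ) (a : Fin (N - 1) → ℂ) (t : ℝ) :
    -- `(D^{(a)})^†` is the adjoint of `D^{(a)}` for the weight `W^{(a)}`
    IsAdjoint (weight a) (opD a) (opDdag a) ∧
    -- the action of `σ`
    (sigma t (opD (scaled t a)) = opD a ∧
      sigma t (opDdag (scaled t a)) = opDdag a ∧
      sigma t (opSecond (scaled t a)) = opSecond a ∧
      sigma t (opCasimir (scaled t a)) = opCasimir a) ∧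
    -- the deformed monic orthogonal polynomials `P_n(x;t)` exist
    (∃ P : ℕ → MatPoly N, IsMonicMVOP (deformedWeight a t) P) ∧
    ∀ P : ℕ → MatPoly N, IsMonicMVOP (deformedWeight a t) P →
      -- the operators lie in the deformed right Fourier algebra
      (opD a ∈ rightFourier P ∧ opDdag a ∈ rightFourier P ∧
        opSecond a ∈ rightFourier P ∧ opCasimir a ∈ rightFourier P) ∧
      -- the polynomials are eigenfunctions, with matrix eigenvalues acting from the left
      ∀ n, ∃ Γ : Matrix (Fin N) (Fin N) ℂ, act (P n) (opSecond a) = constRat Γ * toRat (P n) := by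
  refine ⟨fun P Q => ⟨mapD a P, mapDdag a Q, (act_opD a P).symm, (act_opDdag a Q).symm, ?_⟩,
    ⟨sigma_opD t a, sigma_opDdag t a, sigma_opSecond t a, sigma_opCasimir t a⟩,
    exists_isMonicMVOP a t, fun P hP => ⟨⟨?_, ?_, ?_, ?_⟩, fun n => ?_⟩⟩
  · rw [weight_eq_deformedWeight, matInner_mapD]
  · exact hP.mem_rightFourier (act_opD a) (fun n Q h => h.mapD.mono (Nat.le_succ _))
      (fun n Q h => h.mapDdag) (matInner_mapD a t)
  · exact hP.mem_rightFourier (act_opDdag a) (fun n Q h => h.mapDdag)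
      (fun n Q h => h.mapD.mono (Nat.le_succ _)) (matInner_mapDdag a t)
  · exact hP.mem_rightFourier (act_opSecond a) (fun n Q h => h.mapSecond.mono (Nat.le_succ _))
      (fun n Q h => h.mapSecond.mono (Nat.le_succ _)) (matInner_mapSecond a t)
  · exact hP.mem_rightFourier (act_opCasimir a) (fun n Q h => h.mul_casimirPoly)
      (fun n Q h => h.mul_casimirPoly) (matInner_mul_casimirPoly a t)
  · obtain ⟨Γ, hΓ⟩ := hP.exists_eigenvalue n
    exact ⟨Γ, by rw [act_opSecond, hΓ, toRat_mul]; rfl⟩
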